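/- Let $G=(V,E)$ be a finite connected simple graph with $|E|\ge 2$, and let $k=|V|$. For $F\subset E$ let $d(F)$ be the number of vertices $v\in V$ all of whose incident edges belong to $F$. Let $\mathcal S_G=\{\mathbf x\in\mathbb R^E: x_e\ge 0,\ \sum_{e\in E}x_e=1\}$ and $$\mathcal R_G=\Big\{\mathbf x\in\mathcal S_G:\ \sum_{e\in F}x_e>\tfrac1k d(F)\ \text{ for all }\ \emptyset\subsetneq F\subsetneq E\Big\}.$$ Let $\partial\mathcal R_G$ denote the boundary of $\mathcal R_G$ relative to the hyperplane $\{\mathbf x\in\mathbb R^E:\sum_{e\in E}x_e=1\}$. Write $|\cdot|$ for the Euclidean norm on $\mathbb R^E$ and $\mathrm{dist}$ for the corresponding distance from a point to a set. Consider the following game. The state is an integer vector $\mathbf N(t)\in\mathbb Z^E$ (negative entries are allowed), started from $\mathbf N(0)=\mathbf n$. In round $t=1,2,\dots$ a vertex $V_t$, uniformly distributed on $V$ and independent of the past, is drawn. The player then selects an edge $e$ incident with $V_t$, and $\mathbf N(t)=\mathbf N(t-1)-\mathbf 1^e$, where $\mathbf 1^e$ is the unit coordinate vector of $e$. A randomized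 strategy prescribes, for each history of the previous rounds and each drawn vertex $v$, a probability distribution on the edges incident with $v$, according to which the edge is selected. **Proposition.** Given $\delta>0$, there exist constants $c_1>0$, $\lambda_1>0$, $n_0$, $K_1>0$ and $C_1>0$, depending only on $G$ and $\delta$, such that the following holds. Let $n,n_1$ be any positive integers with $n\ge(1+K_1)n_1$ and $n_1\ge n_0$. Let $\mathbf x,\mathbf z\in\mathcal R_G$ satisfy $\mathrm{dist}(\mathbf x,\partial\mathcal R_G)\ge\delta$ and $\mathrm{dist}(\mathbf z,\partial\mathcal R_G)\ge\delta$, and suppose that $\mathbf n=n\mathbf x$ and $n_1\mathbf z$ have integer coordinates. Then there exists a randomized strategy starting from the state $\mathbf n$ under which $$\mathbf P\big[\mathbf N(n-n_1)=n_1\mathbf z\big]\ge c_1,$$ and, for all real $q\ge 1$, $$\mathbf P\big[\,|\mathbf N(n-n_1)-n_1\mathbf z|>q\,\big]\le C_1\exp(-\lambda_1 q).$$ -/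

import Mathlib

namespace SeqAssign

variable {V : Type*} [Fintype V] [DecidableEq V]

/-- `deg_F(v)`: the number of edges of `F` incident with `v`. -/
def degIn {G : SimpleGraph V} (F : Finset G.edgeSet) (v : V) : ℕ :=
  (F.filter fun e : G.edgeSet => v ∈ (e : Sym2 V)).card

/-- `d(F)`: the number of vertices all of whose incident edges belong to `F`. -/
def d (G : SimpleGraph V) [DecidableRel G.Adj] (F : Finset G.edgeSet) : ℕ :=
  (Finset.univ.filter fun v : V => degIn F v = G.degree v).card

/-- The simplex `S_G` of probability vectors in `ℝ^E`. -/
def simplex (G : SimpleGraph V) [DecidableRel G.Adj] : Set (EuclideanSpace ℝ G.edgeSet) :=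
  {x | (fun e => x e) ∈ stdSimplex ℝ G.edgeSet}

/-- The region `R_G`. -/
def region (G : SimpleGraph V) [DecidableRel G.Adj] : Set (EuclideanSpace ℝ G.edgeSet) :=
  {x | x ∈ simplex G ∧ ∀ F : Finset G.edgeSet, F.Nonempty → F ≠ Finset.univ →
    (d G F : ℝ) / (Fintype.card V : ℝ) < ∑ e ∈ F, x e}

/-- The hyperplane `H_E = {x : ∑_{e ∈ E} x_e = 1}`, the ambient space of `S_G` and `R_G`. -/
def hyperplane (G : SimpleGraph V) [DecidableRel G.Adj] : Set (EuclideanSpace ℝ G.edgeSet) :=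
  {x | ∑ e, x e = 1}

/-- `∂R_G`: the topological boundary of `R_G` as a subset of the hyperplane `H_E`
(with the subspace topology), viewed as a set of points of `ℝ^E`. -/
def regionBoundary (G : SimpleGraph V) [DecidableRel G.Adj] :
    Set (EuclideanSpace ℝ G.edgeSet) :=
  ((↑) : hyperplane G → EuclideanSpace ℝ G.edgeSet) ''
    frontier (((↑) : hyperplane G → EuclideanSpace ℝ G.edgeSet) ⁻¹' region G)

/-- A history of the game: the list of pairs (vertex drawn, edge selected) of the rounds played
so far, the most recent round first. -/
abbrev History (G : SimpleGraph V) := List (V × G.edgeSet)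

/-- A randomized strategy: given the history of the previous rounds and the vertex `v` that has
just been drawn, a probability distribution on the edges incident with `v`. -/
structure RandomizedStrategy (G : SimpleGraph V) where
  /-- The conditional law of the selected edge. -/
  move : History G → V → PMF G.edgeSet
  /-- Only edges incident with the vertex drawn may be selected. -/
  incident : ∀ (h : History G) (v : V) (e : G.edgeSet), e ∈ (move h v).support → v ∈ (e : Sym2 V)

/-- The law of the history of the first `t` rounds: in each round a vertex is drawn uniformly from
`V`, independently of the past, and then an edge is selected according to the strategy. -/
noncomputable def RandomizedStrategy.law {G : SimpleGraph V} [Nonempty V]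
    (σ : RandomizedStrategy G) : ℕ → PMF (History G)
  | 0 => PMF.pure []
  | t + 1 => (σ.law t).bind fun h => (PMF.uniformOfFintype V).bind fun v =>
      (σ.move h v).map fun e => (v, e) :: h

/-- The state of the game after a history, from starting state `n`: each selected edge has its
value decreased by one (negative values are allowed). -/
def state {G : SimpleGraph V} (n : G.edgeSet → ℤ) : History G → (G.edgeSet → ℤ)
  | [] => n
  | (_, e) :: h => state n h - Pi.single e 1

/-- The probability that the state `N(t)` at time `t` satisfies `A`, when the strategy `σ` is used
from the starting state `n`. -/
noncomputable def RandomizedStrategy.prob {G : SimpleGraph V} [Nonempty V]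
    (σ : RandomizedStrategy G) (n : G.edgeSet → ℤ) (t : ℕ) (A : Set (G.edgeSet → ℤ)) : ℝ :=
  ((σ.law t).toOuterMeasure {h | state n h ∈ A}).toReal

/-- An integer vector regarded as a vector of the Euclidean space `ℝ^E`. -/
noncomputable def toEuclid {G : SimpleGraph V} (m : G.edgeSet → ℤ) :
    EuclideanSpace ℝ G.edgeSet :=
  WithLp.toLp 2 fun e => (m e : ℝ)

end SeqAssign

namespace SeqAssign

open scoped ENNReal

/-! With T = n − n₁, the state should follow the segment from n to n₁z, whose velocity is −w for w =
x + (n₁/T)(x − z). If n₁/T is small compared with δ, then w keeps a margin inside the region. The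
greedy player tracks the deviation D from this segment and always picks an incident edge with the
largest coordinate of D.

The constraints of the region say that y-averages of a function on edges are at most the vertex mean
of its maxima over incident edges (`sum_mul_le_mean_max`, by comparing level sets). Applied to w
shifted by a small multiple of D/‖D‖, this gives a drift of D towards 0 (`mean_inner_greedy_le`).
Hence exp(λ‖D‖) contracts up to a constant (`mean_exp_norm_add_le`), and its mean stays bounded
uniformly in time, which yields the tail bound.

To hit the target exactly, greedy play stops s rounds early, s a constant. With probability at least
1/2 every coordinate then still lies above its target, and s uniformly random choices remove exactly
the surplus with probability bounded below (`le_lexp_law_switch`). -/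

/-- The expectation of a nonnegative extended real function under a probability mass function. -/
noncomputable def lexp {α : Type*} (p : PMF α) (f : α → ℝ≥0∞) : ℝ≥0∞ := ∑' a, p a * f a

/-! ### Expectations under probability mass functions and Markov's inequality. -/

section Expectation

variable {α β : Type*}

lemma lexp_pure (a : α) (f : α → ℝ≥0∞) : lexp (PMF.pure a) f = f a := by
  classical
  unfold lexp
  rw [tsum_eq_single a]
  · simp
  · intro b hb
    simp [hb]

lemma lexp_bind (p : PMF α) (g : α → PMF β) (f : β → ℝ≥0∞) :
    lexp (p.bind g) f = lexp p fun a => lexp (g a) f := by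
  unfold lexp
  simp_rw [PMF.bind_apply, ← ENNReal.tsum_mul_right, ← ENNReal.tsum_mul_left]
  rw [ENNReal.tsum_comm]
  simp_rw [mul_assoc]

lemma lexp_map (p : PMF α) (g : α → β) (f : β → ℝ≥0∞) :
    lexp (p.map g) f = lexp p fun a => f (g a) := by
  rw [← PMF.bind_pure_comp, lexp_bind]
  simp [lexp_pure]

lemma lexp_mono (p : PMF α) {f g : α → ℝ≥0∞} (h : ∀ a ∈ p.support, f a ≤ g a) :
    lexp p f ≤ lexp p g := by
  refine ENNReal.tsum_le_tsum fun a => ?_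
  by_cases ha : p a = 0
  · simp [ha]
  · exact mul_le_mul_right (h a ((p.mem_support_iff a).2 ha)) _

lemma lexp_const (p : PMF α) (c : ℝ≥0∞) : lexp p (fun _ => c) = c := by
  unfold lexp
  rw [ENNReal.tsum_mul_right, p.tsum_coe, one_mul]

lemma lexp_mul_add (p : PMF α) (c b : ℝ≥0∞) (f : α → ℝ≥0∞) :
    lexp p (fun a => c * f a + b) = c * lexp p f + b := by
  conv_rhs => rw [← lexp_const p b]
  unfold lexp
  rw [← ENNReal.tsum_mul_left, ← ENNReal.tsum_add]
  refine tsum_congr fun a => ?_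
  ring

lemma lexp_const_mul (p : PMF α) (c : ℝ≥0∞) (f : α → ℝ≥0∞) :
    lexp p (fun a => c * f a) = c * lexp p f := by
  simpa using lexp_mul_add p c 0 f

lemma lexp_uniform [Fintype α] [Nonempty α] (f : α → ℝ≥0∞) :
    lexp (PMF.uniformOfFintype α) f = ∑ a, (Fintype.card α : ℝ≥0∞)⁻¹ * f a := by
  unfold lexp
  rw [tsum_fintype]
  simp

lemma lexp_uniform_ofReal [Fintype α] [Nonempty α] (f : α → ℝ) (hf : ∀ a, 0 ≤ f a) :
    lexp (PMF.uniformOfFintype α) (fun a => ENNReal.ofReal (f a)) =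
      ENNReal.ofReal ((Fintype.card α : ℝ)⁻¹ * ∑ a, f a) := by
  have hk : (0 : ℝ) < Fintype.card α := by exact_mod_cast Fintype.card_pos
  rw [lexp_uniform, ENNReal.ofReal_mul (by positivity), ENNReal.ofReal_inv_of_pos hk,
    ENNReal.ofReal_natCast, ENNReal.ofReal_sum_of_nonneg fun a _ => hf a, Finset.mul_sum]

lemma le_lexp (p : PMF α) (f : α → ℝ≥0∞) (a : α) : p a * f a ≤ lexp p f :=
  ENNReal.le_tsum a

lemma toOuterMeasure_eq_lexp (p : PMF α) (s : Set α) :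
    p.toOuterMeasure s = lexp p (s.indicator fun _ => 1) := by
  classical
  rw [PMF.toOuterMeasure_apply]
  refine tsum_congr fun a => ?_
  by_cases h : a ∈ s <;> simp [h]

lemma toOuterMeasure_ne_top (p : PMF α) (s : Set α) : p.toOuterMeasure s ≠ ∞ := by
  have : p.toOuterMeasure s ≤ 1 := by
    rw [toOuterMeasure_eq_lexp]
    refine le_of_le_of_eq ?_ (lexp_const p 1)
    exact lexp_mono p fun a _ => Set.indicator_le_self' (fun _ _ => zero_le) a
  exact ne_top_of_le_ne_top ENNReal.one_ne_top this

/-- Markov's inequality for exponential moments. -/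
lemma toOuterMeasure_lt_le (p : PMF α) (g : α → ℝ) {lam : ℝ} (hlam : 0 ≤ lam) (q : ℝ) :
    p.toOuterMeasure {a | q < g a} ≤
      ENNReal.ofReal (Real.exp (-lam * q)) *
        lexp p fun a => ENNReal.ofReal (Real.exp (lam * g a)) := by
  rw [toOuterMeasure_eq_lexp, ← lexp_const_mul]
  refine lexp_mono p fun a _ => Set.indicator_apply_le' (fun h => ?_) fun _ => zero_le
  rw [← ENNReal.ofReal_mul (Real.exp_pos _).le, ← Real.exp_add, ← ENNReal.ofReal_one]
  refine ENNReal.ofReal_le_ofReal (Real.one_le_exp ?_)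
  have h' : q < g a := h
  nlinarith

lemma one_le_toOuterMeasure_add_compl (p : PMF α) (s : Set α) :
    1 ≤ p.toOuterMeasure s + p.toOuterMeasure sᶜ := by
  rw [← lexp_const p 1, toOuterMeasure_eq_lexp, toOuterMeasure_eq_lexp]
  unfold lexp
  rw [← ENNReal.tsum_add]
  refine ENNReal.tsum_le_tsum fun a => ?_
  by_cases h : a ∈ s <;> simp [h]

end Expectation

/-! ### Comparison of weighted sums through level sets. -/

section LayerCake

/-- A weighted sum is nonnegative if the total weight vanishes and every upper level set has
nonnegative weight. -/
lemma sum_mul_nonneg_of_level {ι : Type*} [Fintype ι] (w f : ι → ℝ) (hw : ∑ i, w i = 0)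
    (h : ∀ t, 0 ≤ ∑ i with t < f i, w i) : 0 ≤ ∑ i, w i * f i := by
  set B : ℝ := ∑ i, |f i|
  have hB : ∀ i, |f i| ≤ B := fun i =>
    Finset.single_le_sum (f := fun i => |f i|) (fun j _ => abs_nonneg _) (Finset.mem_univ i)
  have hint : ∀ i, IntervalIntegrable (fun t => if t < f i then (1 : ℝ) else 0)
      MeasureTheory.volume (-B) B := by
    intro i
    refine AntitoneOn.intervalIntegrable fun s _ t _ hst => ?_
    have hlt : t < f i → s < f i := hst.trans_lt
    split_ifs with h1 h2 <;> first | exact absurd (hlt h1) h2 | norm_num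
  -- The offset `B` disappears after weighting, since the weights sum to zero.
  have hval : ∀ i, ∫ t in (-B)..B, (if t < f i then (1 : ℝ) else 0) = f i + B := by
    intro i
    have h1 := abs_le.1 (hB i)
    rw [← intervalIntegral.integral_add_adjacent_intervals (b := f i)]
    · have e1 : ∫ t in (-B)..(f i), (if t < f i then (1 : ℝ) else 0) = ∫ t in (-B)..(f i), 1 := by
        refine intervalIntegral.integral_congr_ae ?_
        have : ∀ᵐ t : ℝ, t ≠ f i := by
          simp [MeasureTheory.ae_iff]
        filter_upwards [this] with t ht hmem
        rw [Set.uIoc_of_le h1.1] at hmem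
        simp [lt_of_le_of_ne hmem.2 ht]
      have e2 : ∫ t in (f i)..B, (if t < f i then (1 : ℝ) else 0) = ∫ t in (f i)..B, 0 := by
        refine intervalIntegral.integral_congr fun t ht => ?_
        rw [Set.uIcc_of_le h1.2] at ht
        simp [not_lt.2 ht.1]
      rw [e1, e2]
      simp
    · exact (hint i).mono_set (by
        rw [Set.uIcc_of_le h1.1, Set.uIcc_of_le (by linarith)]
        exact Set.Icc_subset_Icc_right h1.2)
    · exact (hint i).mono_set (by
        rw [Set.uIcc_of_le h1.2, Set.uIcc_of_le (by linarith)]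
        exact Set.Icc_subset_Icc_left h1.1)
  have key : ∑ i, w i * f i =
      ∫ t in (-B)..B, ∑ i, w i * (if t < f i then (1 : ℝ) else 0) := by
    rw [intervalIntegral.integral_finsetSum fun i _ => (hint i).const_mul (w i)]
    simp_rw [intervalIntegral.integral_const_mul, hval, mul_add, Finset.sum_add_distrib,
      ← Finset.sum_mul, hw]
    simp
  have hB0 : 0 ≤ B := Finset.sum_nonneg fun i _ => abs_nonneg _
  rw [key]
  refine intervalIntegral.integral_nonneg (by linarith) fun t _ => ?_
  have := h t
  rw [Finset.sum_filter] at this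
  simpa using this

/-- Stochastic domination between two index types, reduced to one signed weight, `-a` and `b`, on
the disjoint union. -/
lemma sum_mul_le_of_level {α β : Type*} [Fintype α] [Fintype β] (a f : α → ℝ) (b g : β → ℝ)
    (hab : ∑ i, a i = ∑ j, b j)
    (h : ∀ t, ∑ i with t < f i, a i ≤ ∑ j with t < g j, b j) :
    ∑ i, a i * f i ≤ ∑ j, b j * g j := by
  have := sum_mul_nonneg_of_level (ι := α ⊕ β) (Sum.elim (fun i => -a i) b) (Sum.elim f g)
    (by simp [hab]) (fun t => by
      have := h t
      rw [Finset.sum_filter] at this ⊢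
      rw [Finset.sum_filter] at this
      rw [Fintype.sum_sum_type]
      change 0 ≤ ∑ i, (if t < f i then -a i else 0) + ∑ j, (if t < g j then b j else 0)
      have e : ∀ i, (if t < f i then -a i else 0) = -(if t < f i then a i else 0) := by
        intro i; split_ifs <;> simp
      simp_rw [e, Finset.sum_neg_distrib]
      linarith)
  simp only [Fintype.sum_sum_type, Sum.elim_inl, Sum.elim_inr, neg_mul,
    Finset.sum_neg_distrib] at this
  linarith

end LayerCake

/-! ### Exponential Lyapunov function of the norm. -/

section Drift

open scoped InnerProductSpace

variable {H ι : Type*} [NormedAddCommGroup H] [InnerProductSpace ℝ H] [Fintype ι] [Nonempty ι]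

/-- `‖D + Δ‖ ≤ ‖D‖ + ⟪D, Δ⟫ / ‖D‖ + ‖Δ‖² / (2 ‖D‖)`, with denominators cleared. -/
lemma norm_mul_norm_add_le (D Δ : H) :
    ‖D‖ * ‖D + Δ‖ ≤ ‖D‖ ^ 2 + ⟪D, Δ⟫_ℝ + ‖Δ‖ ^ 2 / 2 := by
  have h := norm_add_sq_real D Δ
  nlinarith [sq_nonneg (‖D‖ - ‖D + Δ‖)]

/-- One-step contraction of an exponential Lyapunov function of the norm, for bounded increments
whose mean points inwards. -/
lemma mean_exp_norm_add_le (D : H) (Δ : ι → H) {ε : ℝ} (hε : 0 < ε) (hε1 : ε ≤ 1)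
    (hΔ : ∀ v, ‖Δ v‖ ≤ 2)
    (hdrift : (Fintype.card ι : ℝ)⁻¹ * ∑ v, ⟪D, Δ v⟫_ℝ ≤ -ε * ‖D‖) :
    (Fintype.card ι : ℝ)⁻¹ * ∑ v, Real.exp (ε / 16 * ‖D + Δ v‖) ≤
      (1 - ε ^ 2 / 64) * Real.exp (ε / 16 * ‖D‖) + Real.exp (ε / 16 * (4 / ε + 2)) := by
  have hk : (0 : ℝ) < Fintype.card ι := by exact_mod_cast Fintype.card_pos
  have hki : (0 : ℝ) < (Fintype.card ι : ℝ)⁻¹ := inv_pos.2 hk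
  have hconst : ∀ c : ℝ, (Fintype.card ι : ℝ)⁻¹ * ∑ _v : ι, c = c := by
    intro c
    simp [hk.ne']
  have hρ : 0 ≤ 1 - ε ^ 2 / 64 := by nlinarith
  -- Near the origin the additive constant absorbs everything; the drift is needed only far out.
  rcases lt_or_ge ‖D‖ (4 / ε) with hD | hD
  · have h1 : (Fintype.card ι : ℝ)⁻¹ * ∑ v, Real.exp (ε / 16 * ‖D + Δ v‖) ≤
        (Fintype.card ι : ℝ)⁻¹ * ∑ _v : ι, Real.exp (ε / 16 * (4 / ε + 2)) := by
      gcongr with v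
      exact (norm_add_le _ _).trans (add_le_add hD.le (hΔ v))
    rw [hconst] at h1
    have := mul_nonneg hρ (Real.exp_pos (ε / 16 * ‖D‖)).le
    linarith
  · have hD0 : 0 < ‖D‖ := lt_of_lt_of_le (by positivity) hD
    have hεD : 4 ≤ ε * ‖D‖ := by
      rw [div_le_iff₀ hε] at hD
      linarith
    set X : ι → ℝ := fun v => ‖D + Δ v‖ - ‖D‖ with hX
    have hX2 : ∀ v, |X v| ≤ 2 := fun v => by
      have := abs_norm_sub_norm_le (D + Δ v) D
      rw [add_sub_cancel_left] at this
      exact this.trans (hΔ v)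
    have hXle : ∀ v, ‖D‖ * X v ≤ ⟪D, Δ v⟫_ℝ + 2 := fun v => by
      have h1 := norm_mul_norm_add_le D (Δ v)
      have h2 : ‖Δ v‖ ^ 2 ≤ 2 ^ 2 := by gcongr; exact hΔ v
      simp only [hX]
      nlinarith
    -- The second-order error `2 / ‖D‖` costs at most half of the drift, as `‖D‖ ≥ 4 / ε`.
    have hmean : (Fintype.card ι : ℝ)⁻¹ * ∑ v, X v ≤ -ε / 2 := by
      have h1 : (Fintype.card ι : ℝ)⁻¹ * ∑ v, ‖D‖ * X v ≤
          (Fintype.card ι : ℝ)⁻¹ * ∑ v, (⟪D, Δ v⟫_ℝ + 2) := by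
        gcongr with v
        exact hXle v
      rw [Finset.sum_add_distrib, mul_add, hconst, ← Finset.mul_sum] at h1
      have h2 : ‖D‖ * ((Fintype.card ι : ℝ)⁻¹ * ∑ v, X v) ≤ ‖D‖ * (-ε / 2) := by
        nlinarith
      exact le_of_mul_le_mul_left h2 hD0
    have hexp : ∀ v, Real.exp (ε / 16 * X v) ≤ 1 + ε / 16 * X v + 4 * (ε / 16) ^ 2 := fun v => by
      have h0 : |ε / 16 * X v| ≤ 1 := by
        rw [abs_mul, abs_of_pos (by positivity)]
        nlinarith [hX2 v, abs_nonneg (X v)]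
      have h1 := (abs_le.1 (Real.abs_exp_sub_one_sub_id_le h0)).2
      have h2 : X v ^ 2 ≤ 4 := by nlinarith [abs_le.1 (hX2 v)]
      nlinarith [sq_nonneg (ε / 16)]
    -- With λ = ε/16 the drift gives −λε/2 = −ε²/32, and the quadratic term 4λ² = ε²/64 takes back
    -- half of it.
    have hsum : (Fintype.card ι : ℝ)⁻¹ * ∑ v, Real.exp (ε / 16 * X v) ≤ 1 - ε ^ 2 / 64 := by
      have h1 : (Fintype.card ι : ℝ)⁻¹ * ∑ v, Real.exp (ε / 16 * X v) ≤
          (Fintype.card ι : ℝ)⁻¹ * ∑ v, (1 + ε / 16 * X v + 4 * (ε / 16) ^ 2) := by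
        gcongr with v
        exact hexp v
      rw [Finset.sum_add_distrib, Finset.sum_add_distrib, ← Finset.mul_sum, mul_add, mul_add,
        hconst, hconst] at h1
      nlinarith
    have hfac : ∀ v, Real.exp (ε / 16 * ‖D + Δ v‖) =
        Real.exp (ε / 16 * X v) * Real.exp (ε / 16 * ‖D‖) := fun v => by
      rw [← Real.exp_add]
      congr 1
      simp only [hX]
      ring
    simp_rw [hfac]
    rw [← Finset.sum_mul, ← mul_assoc]
    have := mul_le_mul_of_nonneg_right hsum (Real.exp_pos (ε / 16 * ‖D‖)).le
    have := Real.exp_pos (ε / 16 * (4 / ε + 2))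
    linarith

end Drift

/-! ### Geometry of the region and the inward drift of greedy play. -/

section Region

variable {V : Type*} [Fintype V] [DecidableEq V] {G : SimpleGraph V} [DecidableRel G.Adj]

lemma degIn_univ (v : V) : degIn (Finset.univ : Finset G.edgeSet) v = G.degree v := by
  rw [← G.card_incidenceFinset_eq_degree v]
  refine Finset.card_bij (fun e _ => (e : Sym2 V)) ?_ ?_ ?_
  · intro e he
    rw [SimpleGraph.mem_incidenceFinset]
    exact ⟨e.2, (Finset.mem_filter.1 he).2⟩
  · intro a _ b _ h
    exact Subtype.ext h
  · intro e he
    rw [SimpleGraph.mem_incidenceFinset] at he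
    exact ⟨⟨e, he.1⟩, Finset.mem_filter.2 ⟨Finset.mem_univ _, he.2⟩, rfl⟩

lemma degIn_eq_degree_iff (F : Finset G.edgeSet) (v : V) :
    degIn F v = G.degree v ↔ ∀ e : G.edgeSet, v ∈ (e : Sym2 V) → e ∈ F := by
  rw [← degIn_univ v]
  unfold degIn
  constructor
  · intro h e he
    have heq := Finset.eq_of_subset_of_card_le
      (Finset.filter_subset_filter (fun e : G.edgeSet => v ∈ (e : Sym2 V))
        (Finset.subset_univ F)) h.ge
    have : e ∈ Finset.univ.filter fun e : G.edgeSet => v ∈ (e : Sym2 V) :=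
      Finset.mem_filter.2 ⟨Finset.mem_univ _, he⟩
    rw [← heq] at this
    exact (Finset.mem_filter.1 this).1
  · intro h
    congr 1
    ext e
    simp only [Finset.mem_filter, Finset.mem_univ, true_and, and_iff_right_iff_imp]
    exact h e

/-- If every proper edge set satisfies the (closed) constraints defining the region, a linear
functional is at most the mean over the vertices of its largest value on an incident edge. -/
lemma sum_mul_le_mean_max [Nonempty V] (y c : G.edgeSet → ℝ) (hy : ∑ e, y e = 1)
    (hF : ∀ F : Finset G.edgeSet, F.Nonempty → F ≠ Finset.univ →
      (d G F : ℝ) / Fintype.card V ≤ ∑ e ∈ F, y e)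
    (best : V → G.edgeSet) (hinc : ∀ v, v ∈ (best v : Sym2 V))
    (hbest : ∀ v (e : G.edgeSet), v ∈ (e : Sym2 V) → c e ≤ c (best v)) :
    ∑ e, y e * c e ≤ (Fintype.card V : ℝ)⁻¹ * ∑ v, c (best v) := by
  have hk : (0 : ℝ) < Fintype.card V := by exact_mod_cast Fintype.card_pos
  rw [Finset.mul_sum]
  refine sum_mul_le_of_level y c (fun _ : V => (Fintype.card V : ℝ)⁻¹) (fun v => c (best v))
    (by simp [hy, hk.ne']) fun t => ?_
  -- A vertex is counted by `d G F` exactly when its best value is at most `t`, so the constraint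
  -- for this lower level set is the complemented level inequality.
  set F : Finset G.edgeSet := Finset.univ.filter fun e => ¬ t < c e with hFdef
  have hsplit := Finset.sum_filter_add_sum_filter_not Finset.univ (fun e => t < c e) y
  have hd : d G F = (Finset.univ.filter fun v => ¬ t < c (best v)).card := by
    unfold d
    congr 1
    ext v
    simp only [Finset.mem_filter, Finset.mem_univ, true_and, degIn_eq_degree_iff, hFdef, not_lt]
    exact ⟨fun h => h _ (hinc v), fun h e he => (hbest v e he).trans h⟩
  have hle : (d G F : ℝ) / Fintype.card V ≤ ∑ e ∈ F, y e := by
    rcases F.eq_empty_or_nonempty with h0 | h0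
    · have : d G F = 0 := by
        rw [hd, Finset.card_eq_zero, Finset.filter_eq_empty_iff]
        intro v _ hv
        have : best v ∈ F := Finset.mem_filter.2 ⟨Finset.mem_univ _, hv⟩
        simp [h0] at this
      rw [this]
      simp [h0]
    · by_cases h1 : F = Finset.univ
      · rw [h1, hy, div_le_one hk]
        exact_mod_cast Finset.card_le_univ _
      · exact hF F h0 h1
  have hcard := Finset.card_filter_add_card_filter_not (s := (Finset.univ : Finset V))
    (fun v => t < c (best v))
  rw [← hd, Finset.card_univ] at hcard
  have hcard' : ((Finset.univ.filter fun v => t < c (best v)).card : ℝ) + d G F =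
    Fintype.card V := by exact_mod_cast hcard
  rw [Finset.sum_const, nsmul_eq_mul, ← div_eq_mul_inv]
  have : ((Finset.univ.filter fun v => t < c (best v)).card : ℝ) / Fintype.card V =
      1 - (d G F : ℝ) / Fintype.card V := by
    field_simp
    linarith
  rw [this]
  linarith

/-- Points of the region at distance at least `δ` from its boundary satisfy the defining
inequalities with a margin. -/
lemma region_margin {x : EuclideanSpace ℝ G.edgeSet} {δ : ℝ} (hδ : 0 < δ) (hx : x ∈ region G)
    (hdist : δ ≤ Metric.infDist x (regionBoundary G)) (F : Finset G.edgeSet) (h0 : F.Nonempty)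
    (h1 : F ≠ Finset.univ) :
    (d G F : ℝ) / Fintype.card V + δ / 3 ≤ ∑ e ∈ F, x e := by
  obtain ⟨a, ha⟩ := h0
  obtain ⟨b, hb⟩ : ∃ b, b ∉ F := by
    by_contra! h
    exact h1 (Finset.eq_univ_iff_forall.2 h)
  have hab : a ≠ b := fun h => hb (h ▸ ha)
  -- Moving against `u` shifts mass from inside `F` to outside it. A path of length at most 2δ/3
  -- cannot meet the boundary, so by connectedness it ends in the region, with the sum over `F`
  -- lowered by δ/3.
  set u : EuclideanSpace ℝ G.edgeSet := EuclideanSpace.single a 1 - EuclideanSpace.single b 1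
    with hu
  have hunorm : ‖u‖ ≤ 2 := by
    refine (norm_sub_le _ _).trans ?_
    simp
    norm_num
  have hxsum : ∑ e, x e = 1 := hx.1.2
  have husum : ∑ e, u e = 0 := by simp [hu]
  have huF : ∑ e ∈ F, u e = 1 := by
    simp [hu, ha, hb]
  let f : unitInterval → hyperplane G := fun t => ⟨x - ((t : ℝ) * (δ / 3)) • u, by
    change ∑ e, (x - ((t : ℝ) * (δ / 3)) • u) e = 1
    simp only [PiLp.sub_apply, PiLp.smul_apply, smul_eq_mul, Finset.sum_sub_distrib,
      ← Finset.mul_sum, hxsum, husum]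
    simp⟩
  have hf : Continuous f := by
    refine Continuous.subtype_mk ?_ _
    fun_prop
  set S : Set (hyperplane G) := ((↑) : hyperplane G → EuclideanSpace ℝ G.edgeSet) ⁻¹' region G
  have hf0 : f 0 ∈ S := by
    change x - (((0 : unitInterval) : ℝ) * (δ / 3)) • u ∈ region G
    simpa using hx
  have hf1 : f 1 ∈ S := by
    by_contra hf1
    have hne : (frontier (f ⁻¹' S)).Nonempty := by
      rw [nonempty_frontier_iff]
      exact ⟨⟨0, hf0⟩, fun h => hf1 (by
        have : (1 : unitInterval) ∈ f ⁻¹' S := h ▸ Set.mem_univ _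
        exact this)⟩
    obtain ⟨t, ht⟩ := hne
    have hbd : (f t : EuclideanSpace ℝ G.edgeSet) ∈ regionBoundary G :=
      ⟨f t, hf.frontier_preimage_subset S ht, rfl⟩
    have h2 := Metric.infDist_le_dist_of_mem (x := x) hbd
    have h3 : dist x (f t : EuclideanSpace ℝ G.edgeSet) ≤ (t : ℝ) * (δ / 3) * 2 := by
      rw [dist_eq_norm]
      change ‖x - (x - ((t : ℝ) * (δ / 3)) • u)‖ ≤ _
      have ht0 := t.2.1
      rw [sub_sub_cancel, norm_smul, Real.norm_of_nonneg (by positivity)]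
      gcongr
    have := t.2.2
    nlinarith
  have h4 := hf1.2 F ⟨a, ha⟩ h1
  change _ < ∑ e ∈ F, (x - (((1 : unitInterval) : ℝ) * (δ / 3)) • u) e at h4
  simp only [PiLp.sub_apply, PiLp.smul_apply, smul_eq_mul, Finset.sum_sub_distrib,
      ← Finset.mul_sum, huF, Set.Icc.coe_one] at h4
  linarith

/-- The greedy choice drifts inwards: if `w` satisfies the constraints of the region with margin
`ε |E|`, then always choosing an incident edge with the largest coordinate of `D` decreases
`D` on average. -/
lemma mean_inner_greedy_le [Nonempty V] (w D : EuclideanSpace ℝ G.edgeSet) {ε : ℝ} (hε : 0 ≤ ε)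
    (hw : ∑ e, w e = 1) (hD : ∑ e, D e = 0)
    (hF : ∀ F : Finset G.edgeSet, F.Nonempty → F ≠ Finset.univ →
      (d G F : ℝ) / Fintype.card V + ε * Fintype.card G.edgeSet ≤ ∑ e ∈ F, w e)
    (best : V → G.edgeSet) (hinc : ∀ v, v ∈ (best v : Sym2 V))
    (hbest : ∀ v (e : G.edgeSet), v ∈ (e : Sym2 V) → D e ≤ D (best v)) :
    (Fintype.card V : ℝ)⁻¹ * ∑ v, inner ℝ D (w - EuclideanSpace.single (best v) 1) ≤
      -ε * ‖D‖ := by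
  have hk : (0 : ℝ) < Fintype.card V := by exact_mod_cast Fintype.card_pos
  have hle : ∀ e, -1 ≤ D e / ‖D‖ := fun e => by
    rcases (norm_nonneg D).eq_or_lt with h | h
    · simp [← h]
    · rw [le_div_iff₀ h]
      have := (abs_le.1 (PiLp.norm_apply_le D e)).1
      linarith
  -- The shift keeps the total equal to 1 because `D` sums to zero, and lowers a sum over `F` by at
  -- most ε|E|, which the margin covers. Pairing it with `D` produces ε‖D‖. For `D = 0` the quotient
  -- is 0.
  have key := sum_mul_le_mean_max (fun e => w e + ε * (D e / ‖D‖)) D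
    (by rw [Finset.sum_add_distrib, ← Finset.mul_sum, ← Finset.sum_div, hw, hD]; simp)
    (fun F h0 h1 => by
      have h2 := hF F h0 h1
      have h3 : ∑ e ∈ F, (-ε) ≤ ∑ e ∈ F, ε * (D e / ‖D‖) :=
        Finset.sum_le_sum fun e _ => by nlinarith [hle e]
      have h4 : (F.card : ℝ) ≤ Fintype.card G.edgeSet := by exact_mod_cast Finset.card_le_univ F
      rw [Finset.sum_const, nsmul_eq_mul] at h3
      rw [Finset.sum_add_distrib]
      nlinarith) best hinc hbest
  have hlhs : ∑ e, (w e + ε * (D e / ‖D‖)) * D e = ∑ e, w e * D e + ε * ‖D‖ := by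
    have h1 : ∑ e, ε * (D e / ‖D‖) * D e = ε * ‖D‖ := by
      have h2 := EuclideanSpace.real_norm_sq_eq D
      have h3 : ∑ e, ε * (D e / ‖D‖) * D e = ε * ((∑ e, D e ^ 2) / ‖D‖) := by
        rw [Finset.sum_div, Finset.mul_sum]
        refine Finset.sum_congr rfl fun e _ => ?_
        ring
      rw [h3, ← h2, pow_two, mul_self_div_self]
    simp_rw [add_mul, Finset.sum_add_distrib]
    rw [h1]
  have hin : ∀ v, inner ℝ D (w - EuclideanSpace.single (best v) 1) =
      ∑ e, w e * D e - D (best v) := fun v => by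
    rw [inner_sub_right, EuclideanSpace.inner_single_right, PiLp.inner_apply]
    simp
  simp_rw [hin]
  rw [Finset.sum_sub_distrib, mul_sub, Finset.sum_const, Finset.card_univ, nsmul_eq_mul,
    inv_mul_cancel_left₀ hk.ne']
  linarith

lemma norm_sub_single_le (w : EuclideanSpace ℝ G.edgeSet) (hw0 : ∀ e, 0 ≤ w e)
    (hw : ∑ e, w e = 1) (e : G.edgeSet) : ‖w - EuclideanSpace.single e 1‖ ≤ 2 := by
  have h1 : ‖w‖ ≤ 1 := by
    rw [← sq_le_one_iff₀ (norm_nonneg _), EuclideanSpace.real_norm_sq_eq, ← hw]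
    refine Finset.sum_le_sum fun e _ => ?_
    have : w e ≤ 1 := hw ▸ Finset.single_le_sum (fun i _ => hw0 i) (Finset.mem_univ e)
    nlinarith [hw0 e]
  refine (norm_sub_le _ _).trans ?_
  have : ‖(EuclideanSpace.single e 1 : EuclideanSpace ℝ G.edgeSet)‖ = 1 := by simp
  linarith

end Region

/-! ### The game, the deviation process and the two-phase strategy. -/

section Game

variable {V : Type*} {G : SimpleGraph V}

lemma lexp_law_succ [Fintype V] [Nonempty V] (σ : RandomizedStrategy G) (t : ℕ) (f : History G → ℝ≥0∞) :
    lexp (σ.law (t + 1)) f = lexp (σ.law t) fun h =>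
      lexp (PMF.uniformOfFintype V) fun v => lexp (σ.move h v) fun e => f ((v, e) :: h) := by
  simp only [RandomizedStrategy.law, lexp_bind, lexp_map]

/-- A strategy sees only the history, so the length of the history serves as the clock. -/
lemma length_of_mem_support_law [Fintype V] [Nonempty V] (σ : RandomizedStrategy G) (t : ℕ) (h : History G)
    (hh : h ∈ (σ.law t).support) : h.length = t := by
  induction t generalizing h with
  | zero =>
    simp only [RandomizedStrategy.law, PMF.support_pure, Set.mem_singleton_iff] at hh
    simp [hh]
  | succ t ih =>
    simp only [RandomizedStrategy.law, PMF.mem_support_bind_iff, PMF.mem_support_map_iff] at hh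
    obtain ⟨h', hh', v, _, e, _, rfl⟩ := hh
    simp [ih h' hh']

/-- If increments of `g` are at most `2`, exponential moments grow by a bounded factor per round. -/
lemma lexp_law_add_le [Fintype V] [Nonempty V] (σ : RandomizedStrategy G) (g : History G → ℝ) {lam : ℝ}
    (hlam : 0 ≤ lam) (hg : ∀ h v e, g ((v, e) :: h) ≤ g h + 2) (t j : ℕ) :
    lexp (σ.law (t + j)) (fun h => ENNReal.ofReal (Real.exp (lam * g h))) ≤
      ENNReal.ofReal (Real.exp (lam * 2)) ^ j *
        lexp (σ.law t) (fun h => ENNReal.ofReal (Real.exp (lam * g h))) := by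
  induction j with
  | zero => simp
  | succ j ih =>
    rw [pow_succ', mul_assoc]
    refine le_trans ?_ (mul_le_mul_right ih _)
    rw [← add_assoc, lexp_law_succ, ← lexp_const_mul]
    refine lexp_mono _ fun h _ => ?_
    refine le_of_le_of_eq (lexp_mono _ fun v _ => ?_) (lexp_const _ _)
    refine le_of_le_of_eq (lexp_mono _ fun e _ => ?_) (lexp_const _ _)
    rw [← ENNReal.ofReal_mul (Real.exp_pos _).le, ← Real.exp_add]
    refine ENNReal.ofReal_le_ofReal (Real.exp_le_exp.2 ?_)
    nlinarith [hg h v e]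

variable [DecidableEq V]

lemma sum_state [Fintype G.edgeSet] (n : G.edgeSet → ℤ) (h : History G) :
    ∑ e, state n h e = ∑ e, n e - h.length := by
  induction h with
  | nil => simp [state]
  | cons p h ih =>
    obtain ⟨v, e⟩ := p
    simp only [state, Pi.sub_apply, Finset.sum_sub_distrib, ih, List.length_cons]
    simp
    ring

/-- The deviation of the state from the straight line with velocity `-w`. -/
noncomputable def deviation (n : G.edgeSet → ℤ) (w : EuclideanSpace ℝ G.edgeSet)
    (h : History G) : EuclideanSpace ℝ G.edgeSet :=
  toEuclid (state n h) - toEuclid n + (h.length : ℝ) • w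

lemma deviation_nil (n : G.edgeSet → ℤ) (w : EuclideanSpace ℝ G.edgeSet) :
    deviation n w [] = 0 := by
  simp [deviation, state]

lemma deviation_cons (n : G.edgeSet → ℤ) (w : EuclideanSpace ℝ G.edgeSet)
    (h : History G) (v : V) (e : G.edgeSet) :
    deviation n w ((v, e) :: h) = deviation n w h + (w - EuclideanSpace.single e 1) := by
  ext i
  simp only [deviation, state, toEuclid, PiLp.add_apply, PiLp.sub_apply, PiLp.smul_apply,
    Pi.sub_apply, List.length_cons, smul_eq_mul, PiLp.single_apply, Pi.single_apply]
  push_cast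
  ring

/-- Needed for the drift estimate, where `w` is shifted along the deviation within the hyperplane.
-/
lemma sum_deviation [Fintype G.edgeSet] (n : G.edgeSet → ℤ) (w : EuclideanSpace ℝ G.edgeSet)
    (hw : ∑ e, w e = 1) (h : History G) : ∑ e, deviation n w h e = 0 := by
  have h1 : (∑ e, (state n h e : ℝ)) = ∑ e, (n e : ℝ) - h.length := by
    exact_mod_cast sum_state n h
  simp only [deviation, toEuclid, PiLp.add_apply, PiLp.sub_apply, PiLp.smul_apply, smul_eq_mul,
    Finset.sum_add_distrib, Finset.sum_sub_distrib, ← Finset.mul_sum, hw, h1]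
  ring

variable [Fintype V] [DecidableRel G.Adj]

/-- The edges incident with a vertex. -/
def incidentEdges (G : SimpleGraph V) [DecidableRel G.Adj] (v : V) : Finset G.edgeSet :=
  Finset.univ.filter fun e : G.edgeSet => v ∈ (e : Sym2 V)

lemma mem_incidentEdges {v : V} {e : G.edgeSet} :
    e ∈ incidentEdges G v ↔ v ∈ (e : Sym2 V) := by
  simp [incidentEdges]

lemma incidentEdges_nonempty {v : V} {e : G.edgeSet} (he : v ∈ (e : Sym2 V)) :
    (incidentEdges G v).Nonempty := ⟨e, mem_incidentEdges.2 he⟩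

/-- The strategy that selects a prescribed edge in the first `τ` rounds and a uniformly random
incident edge afterwards. -/
noncomputable def switchStrategy (best : History G → V → G.edgeSet)
    (hinc : ∀ h v, v ∈ (best h v : Sym2 V)) (τ : ℕ) : RandomizedStrategy G where
  move h v := if h.length < τ then PMF.pure (best h v) else
    PMF.uniformOfFinset (incidentEdges G v) (incidentEdges_nonempty (hinc h v))
  incident h v e he := by
    split_ifs at he
    · rw [PMF.support_pure, Set.mem_singleton_iff] at he
      exact he ▸ hinc h v
    · rw [PMF.mem_support_uniformOfFinset_iff] at he
      exact mem_incidentEdges.1 he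

section Switch

variable (best : History G → V → G.edgeSet) (hinc : ∀ h v, v ∈ (best h v : Sym2 V))
  (τ : ℕ)

lemma switchStrategy_move_ge (h : History G) (hh : τ ≤ h.length) (v : V) (e : G.edgeSet)
    (he : v ∈ (e : Sym2 V)) :
    (Fintype.card G.edgeSet : ℝ≥0∞)⁻¹ ≤ (switchStrategy best hinc τ).move h v e := by
  simp only [switchStrategy, not_lt.2 hh, if_false]
  rw [PMF.uniformOfFinset_apply, if_pos (mem_incidentEdges.2 he)]
  gcongr
  exact Finset.card_le_univ _

variable [Nonempty V]

/-- A contracting exponential moment stays bounded during the prescribed rounds. -/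
lemma lexp_law_switch_le (Φ : History G → ℝ) (hΦ : ∀ h, 0 ≤ Φ h) {M ρ B : ℝ}
    (hM : Φ [] ≤ M) (hρ : 0 ≤ ρ) (hB : 0 ≤ B) (hρM : ρ * M + B ≤ M)
    (hstep : ∀ h, (Fintype.card V : ℝ)⁻¹ * ∑ v, Φ ((v, best h v) :: h) ≤ ρ * Φ h + B)
    (t : ℕ) (ht : t ≤ τ) :
    lexp ((switchStrategy best hinc τ).law t) (fun h => ENNReal.ofReal (Φ h)) ≤
      ENNReal.ofReal M := by
  have hM0 : 0 ≤ M := (hΦ []).trans hM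
  induction t with
  | zero =>
    simp only [RandomizedStrategy.law, lexp_pure]
    exact ENNReal.ofReal_le_ofReal hM
  | succ t ih =>
    rw [lexp_law_succ]
    calc _ ≤ lexp ((switchStrategy best hinc τ).law t) (fun h =>
          ENNReal.ofReal ρ * ENNReal.ofReal (Φ h) + ENNReal.ofReal B) := by
          refine lexp_mono _ fun h hh => ?_
          have hlen := length_of_mem_support_law _ t h hh
          have hlt : h.length < τ := by omega
          simp only [switchStrategy, hlt, if_true, lexp_pure]
          rw [lexp_uniform_ofReal _ fun v => hΦ _, ← ENNReal.ofReal_mul hρ,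
            ← ENNReal.ofReal_add (mul_nonneg hρ (hΦ h)) hB]
          exact ENNReal.ofReal_le_ofReal (hstep h)
      _ ≤ ENNReal.ofReal ρ * ENNReal.ofReal M + ENNReal.ofReal B := by
          rw [lexp_mul_add]
          gcongr
          exact ih (by omega)
      _ ≤ ENNReal.ofReal M := by
          rw [← ENNReal.ofReal_mul hρ, ← ENNReal.ofReal_add (mul_nonneg hρ hM0) hB]
          exact ENNReal.ofReal_le_ofReal hρM

/-- From the switching time on, a nonnegative coordinatewise surplus over the target is kept
with probability bounded below in each round. -/
lemma le_lexp_law_switch (n target : G.edgeSet → ℤ) (s : ℕ)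
    (hsum : ∑ e, n e - ∑ e, target e = τ + s) (j : ℕ) (hj : j ≤ s) :
    ((Fintype.card V : ℝ≥0∞)⁻¹ * (Fintype.card G.edgeSet : ℝ≥0∞)⁻¹) ^ j *
        lexp ((switchStrategy best hinc τ).law τ)
          ({h | ∀ e, target e ≤ state n h e}.indicator fun _ => 1) ≤
      lexp ((switchStrategy best hinc τ).law (τ + j))
        ({h | ∀ e, target e ≤ state n h e}.indicator fun _ => 1) := by
  induction j with
  | zero => simp
  | succ j ih =>
    rw [pow_succ', mul_assoc]
    refine (mul_le_mul_right (ih (by omega)) _).trans ?_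
    rw [← add_assoc, lexp_law_succ, ← lexp_const_mul]
    refine lexp_mono _ fun h hh => ?_
    have hlen := length_of_mem_support_law _ _ h hh
    by_cases hA : h ∈ {h : History G | ∀ e, target e ≤ state n h e}
    swap
    · rw [Set.indicator_of_notMem hA, mul_zero]
      exact zero_le
    have hs := sum_state n h
    -- The total surplus is `s - j > 0`, so some edge can still be lowered. Drawing one of its
    -- endpoints and then selecting it preserves the surplus condition.
    obtain ⟨e, he⟩ : ∃ e, target e < state n h e := by
      by_contra! hcon
      have : ∑ e, state n h e ≤ ∑ e, target e := Finset.sum_le_sum fun e _ => hcon e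
      rw [hs, hlen] at this
      push_cast at this
      omega
    obtain ⟨v, hv⟩ : ∃ v, v ∈ (e : Sym2 V) := ⟨_, Sym2.out_fst_mem _⟩
    have hmem : (v, e) :: h ∈ {h : History G | ∀ e, target e ≤ state n h e} := by
      intro i
      have := hA i
      simp only [state, Pi.sub_apply, Pi.single_apply]
      split_ifs with hi
      · subst hi; omega
      · omega
    rw [Set.indicator_of_mem hA, mul_one]
    refine le_trans ?_ (le_lexp _ _ v)
    rw [PMF.uniformOfFintype_apply]
    refine mul_le_mul_right ?_ _
    refine le_trans ?_ (le_lexp _ _ e)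
    rw [Set.indicator_of_mem hmem, mul_one]
    exact switchStrategy_move_ge best hinc τ h (by omega) v e hv

end Switch

lemma exists_best_edge (hG : ∀ v, ∃ e : G.edgeSet, v ∈ (e : Sym2 V)) (c : G.edgeSet → ℝ) :
    ∃ best : V → G.edgeSet, (∀ v, v ∈ (best v : Sym2 V)) ∧
      ∀ v (e : G.edgeSet), v ∈ (e : Sym2 V) → c e ≤ c (best v) := by
  have : ∀ v, ∃ b : G.edgeSet, v ∈ (b : Sym2 V) ∧
      ∀ e : G.edgeSet, v ∈ (e : Sym2 V) → c e ≤ c b := fun v => by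
    obtain ⟨e, he⟩ := hG v
    obtain ⟨b, hb, hmax⟩ := Finset.exists_max_image (incidentEdges G v) c
      ⟨e, mem_incidentEdges.2 he⟩
    exact ⟨b, mem_incidentEdges.1 hb, fun e he => hmax e (mem_incidentEdges.2 he)⟩
  choose best h1 h2 using this
  exact ⟨best, h1, h2⟩

/-- Steering along a straight line whose velocity lies inside the region: the target is hit with
probability bounded below, and the distance to it has uniform exponential tails. -/
lemma exists_steering_strategy [Nonempty V] (hG : ∀ v, ∃ e : G.edgeSet, v ∈ (e : Sym2 V))
    {ε η : ℝ} (hε : 0 < ε) (hε1 : ε ≤ 1) (hη : 0 < η) :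
    ∃ c₁ C₁ : ℝ, ∃ s : ℕ, 0 < c₁ ∧ 0 < C₁ ∧
      ∀ (T : ℕ) (start target : G.edgeSet → ℤ) (w : EuclideanSpace ℝ G.edgeSet), s ≤ T →
        ∑ e, w e = 1 → (∀ e, η ≤ w e) →
        (∀ F : Finset G.edgeSet, F.Nonempty → F ≠ Finset.univ →
          (d G F : ℝ) / Fintype.card V + ε * Fintype.card G.edgeSet ≤ ∑ e ∈ F, w e) →
        toEuclid start - (T : ℝ) • w = toEuclid target →
        ∃ σ : RandomizedStrategy G,
          c₁ ≤ σ.prob start T {N | toEuclid N = toEuclid target} ∧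
          ∀ q : ℝ, σ.prob start T {N | q < ‖toEuclid N - toEuclid target‖} ≤
            C₁ * Real.exp (-(ε / 16) * q) := by
  set lam : ℝ := ε / 16 with hlam
  have hlam0 : 0 < lam := by positivity
  set B : ℝ := Real.exp (lam * (4 / ε + 2))
  have hB : 0 < B := Real.exp_pos _
  -- With contraction factor ρ = 1 − ε²/64 this is 1 + B/(1 − ρ): it bounds the initial value 1 and
  -- satisfies ρM + B ≤ M.
  set M : ℝ := 1 + B * (64 / ε ^ 2)
  have hM : 1 ≤ M := le_add_of_nonneg_right (by positivity)
  -- Chosen so that Markov's inequality bounds the probability of a deviation above `r` by 1/2.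
  set r : ℝ := Real.log (2 * M) / lam
  have hr : 0 ≤ r := div_nonneg (Real.log_nonneg (by linarith)) hlam0.le
  have hrexp : Real.exp (-lam * r) * M = 1 / 2 := by
    have h1 : -lam * r = -Real.log (2 * M) := by
      simp only [r]
      field_simp
    rw [h1, Real.exp_neg, Real.exp_log (by linarith)]
    field_simp
  -- After `s` rounds less than `T`, the segment lies at least `s * η ≥ r` above the target in each
  -- coordinate, enough to absorb a deviation `r`.
  set s : ℕ := ⌈r / η⌉₊
  have hs : r ≤ s * η := by
    rw [← div_le_iff₀ hη]
    exact Nat.le_ceil _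
  set κ : ℝ≥0∞ := (Fintype.card V : ℝ≥0∞)⁻¹ * (Fintype.card G.edgeSet : ℝ≥0∞)⁻¹ with hκ
  obtain ⟨v₀⟩ := ‹Nonempty V›
  have : Nonempty V := ⟨v₀⟩
  have : Nonempty G.edgeSet := ⟨(hG v₀).choose⟩
  have hκ0 : κ ≠ 0 := by simp [hκ]
  have hκt : κ ≠ ∞ := by
    refine ENNReal.mul_ne_top ?_ ?_ <;> simp [Fintype.card_ne_zero]
  have hc0 : κ ^ s * 2⁻¹ ≠ 0 := mul_ne_zero (pow_ne_zero _ hκ0) (by simp)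
  have hct : κ ^ s * 2⁻¹ ≠ ∞ := ENNReal.mul_ne_top (ENNReal.pow_ne_top hκt) (by simp)
  -- `κ` bounds the chance of one required move in the final phase. Each final round increases the
  -- deviation norm by at most 2, whence the factor in the tail constant.
  refine ⟨(κ ^ s * 2⁻¹).toReal, Real.exp (lam * 2) ^ s * M, s, ENNReal.toReal_pos hc0 hct,
    by positivity, ?_⟩
  intro T start target w hsT hw1 hwη hwF htarget
  have hw0 : ∀ e, 0 ≤ w e := fun e => hη.le.trans (hwη e)
  obtain ⟨τ, rfl⟩ : ∃ τ, T = τ + s := ⟨T - s, by omega⟩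
  have hbest := fun h : History G => exists_best_edge hG fun e => deviation start w h e
  choose best hinc hmax using hbest
  have hcoord : ∀ e, (start e : ℝ) - ((τ + s : ℕ) : ℝ) * w e = target e := fun e =>
    congrArg (fun y : EuclideanSpace ℝ G.edgeSet => y e) htarget
  have hsum : ∑ e, start e - ∑ e, target e = τ + s := by
    have h1 : ∑ e, ((start e : ℝ) - ((τ + s : ℕ) : ℝ) * w e) = ∑ e, (target e : ℝ) :=
      Finset.sum_congr rfl fun e _ => hcoord e
    rw [Finset.sum_sub_distrib, ← Finset.mul_sum, hw1] at h1
    have h2 : (∑ e, (start e : ℝ)) - ∑ e, (target e : ℝ) = τ + s := by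
      push_cast at h1
      linarith
    exact_mod_cast h2
  set σ := switchStrategy best hinc τ
  have hmom : lexp (σ.law τ)
      (fun h => ENNReal.ofReal (Real.exp (lam * ‖deviation start w h‖))) ≤
      ENNReal.ofReal M := by
    refine lexp_law_switch_le best hinc τ (fun h => Real.exp (lam * ‖deviation start w h‖))
      (fun h => (Real.exp_pos _).le) (ρ := 1 - ε ^ 2 / 64) (B := B) ?_ (by nlinarith) hB.le ?_ ?_
      τ le_rfl
    · simpa [deviation_nil] using hM
    · have h1 : ε ^ 2 / 64 * M = ε ^ 2 / 64 + B := by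
        simp only [M]
        field_simp
      nlinarith
    · intro h
      simp_rw [deviation_cons]
      exact mean_exp_norm_add_le _ _ hε hε1 (fun v => norm_sub_single_le w hw0 hw1 _)
        (mean_inner_greedy_le w _ hε.le hw1 (sum_deviation start w hw1 h) hwF _ (hinc h) (hmax h))
  have hdev : ∀ h : History G, h.length = τ + s →
      deviation start w h = toEuclid (state start h) - toEuclid target := fun h hh => by
    rw [deviation, hh, ← htarget]
    abel
  refine ⟨σ, ?_, fun q => ?_⟩
  · have hhalf : 2⁻¹ ≤ lexp (σ.law τ)
        ({h | ∀ e, target e ≤ state start h e}.indicator fun _ => 1) := by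
      have h1 := one_le_toOuterMeasure_add_compl (σ.law τ) {h | r < ‖deviation start w h‖}
      have h2 : (σ.law τ).toOuterMeasure {h | r < ‖deviation start w h‖} ≤ 2⁻¹ := by
        refine (toOuterMeasure_lt_le _ _ hlam0.le r).trans ?_
        refine (mul_le_mul_right hmom _).trans ?_
        rw [← ENNReal.ofReal_mul (Real.exp_pos _).le, hrexp, one_div,
          ENNReal.ofReal_inv_of_pos two_pos]
        simp
      have h3 : (σ.law τ).toOuterMeasure {h | r < ‖deviation start w h‖}ᶜ ≤ lexp (σ.law τ)
          ({h | ∀ e, target e ≤ state start h e}.indicator fun _ => 1) := by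
        rw [toOuterMeasure_eq_lexp]
        refine lexp_mono _ fun h hh => Set.indicator_apply_le' (fun hmem => ?_) fun _ => zero_le
        rw [Set.indicator_of_mem]
        intro e
        have hlen := length_of_mem_support_law _ _ h hh
        have h4 : ‖deviation start w h‖ ≤ r := not_lt.1 hmem
        have h5 := (abs_le.1 ((PiLp.norm_apply_le (deviation start w h) e).trans h4)).1
        have h6 : deviation start w h e = state start h e - start e + τ * w e := by
          rw [deviation, hlen]
          rfl
        have h7 := hcoord e
        have h8 : (s : ℝ) * η ≤ s * w e := by
          gcongr
          exact hwη e
        have : (target e : ℝ) ≤ state start h e := by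
          push_cast at h7
          linarith
        exact_mod_cast this
      have h4 : (2⁻¹ : ℝ≥0∞) + 2⁻¹ ≤ 2⁻¹ + lexp (σ.law τ)
          ({h | ∀ e, target e ≤ state start h e}.indicator fun _ => 1) := by
        rw [ENNReal.inv_two_add_inv_two]
        exact h1.trans (add_le_add h2 h3)
      exact (ENNReal.add_le_add_iff_left (by simp)).1 h4
    unfold RandomizedStrategy.prob
    refine ENNReal.toReal_mono (toOuterMeasure_ne_top _ _) ?_
    refine (mul_le_mul_right hhalf _).trans ?_
    refine (le_lexp_law_switch best hinc τ start target s hsum s le_rfl).trans ?_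
    rw [toOuterMeasure_eq_lexp]
    refine lexp_mono _ fun h hh => Set.indicator_apply_le' (fun hmem => ?_) fun _ => zero_le
    rw [Set.indicator_of_mem]
    have hlen := length_of_mem_support_law _ _ h hh
    have h1 : ∑ e, state start h e = ∑ e, target e := by
      rw [sum_state, hlen]
      push_cast
      omega
    -- Coordinatewise domination with equal totals forces equality.
    have h2 := (Finset.sum_eq_sum_iff_of_le fun e _ => hmem e).1 h1.symm
    change toEuclid (state start h) = toEuclid target
    congr 1
    funext e
    exact (h2 e (Finset.mem_univ e)).symm
  · have hC : 0 ≤ Real.exp (lam * 2) ^ s * M * Real.exp (-lam * q) := by positivity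
    unfold RandomizedStrategy.prob
    refine ENNReal.toReal_le_of_le_ofReal hC ?_
    have h1 : (σ.law (τ + s)).toOuterMeasure
        {h | state start h ∈ {N | q < ‖toEuclid N - toEuclid target‖}} ≤
        (σ.law (τ + s)).toOuterMeasure {h | q < ‖deviation start w h‖} := by
      rw [toOuterMeasure_eq_lexp, toOuterMeasure_eq_lexp]
      refine lexp_mono _ fun h hh => Set.indicator_apply_le' (fun hmem => ?_) fun _ => zero_le
      rw [Set.indicator_of_mem]
      change q < _
      rw [hdev h (length_of_mem_support_law _ _ h hh)]
      exact hmem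
    refine h1.trans ((toOuterMeasure_lt_le _ _ hlam0.le q).trans ?_)
    have h2 := lexp_law_add_le σ (fun h => ‖deviation start w h‖) hlam0.le (fun h v e => by
      rw [deviation_cons]
      exact (norm_add_le _ _).trans (add_le_add_right (norm_sub_single_le w hw0 hw1 e) _)) τ s
    refine (mul_le_mul_right (h2.trans (mul_le_mul_right hmom _)) _).trans ?_
    rw [← ENNReal.ofReal_pow (Real.exp_pos _).le, ← ENNReal.ofReal_mul (by positivity),
      ← ENNReal.ofReal_mul (Real.exp_pos _).le]
    exact ENNReal.ofReal_le_ofReal (le_of_eq (by ring))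

end Game

/-! ### Choice of the constants and conclusion. -/

lemma exists_incident_edge {V : Type*} [Fintype V] {G : SimpleGraph V} [DecidableRel G.Adj]
    (hconn : G.Connected) (hE : Nonempty G.edgeSet) (v : V) :
    ∃ e : G.edgeSet, v ∈ (e : Sym2 V) := by
  obtain ⟨⟨e, he⟩⟩ := hE
  have : Nontrivial V := by
    induction e using Sym2.ind with
    | _ a b => exact ⟨a, b, (G.mem_edgeSet.1 he).ne⟩
  have hdeg := hconn.preconnected.degree_pos_of_nontrivial v
  obtain ⟨u, hu⟩ := (G.degree_pos_iff_exists_adj v).1 hdeg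
  exact ⟨⟨s(v, u), hu⟩, Sym2.mem_mk_left v u⟩

end SeqAssign

theorem mainTheorem7 {V : Type*} [Fintype V] [DecidableEq V] [Nonempty V]
    (G : SimpleGraph V) [DecidableRel G.Adj] (hconn : G.Connected)
    (hE : 2 ≤ Fintype.card G.edgeSet) (δ : ℝ) (hδ : 0 < δ) :
    ∃ c₁ lam₁ K₁ C₁ : ℝ, ∃ n₀ : ℕ, 0 < c₁ ∧ 0 < lam₁ ∧ 0 < K₁ ∧ 0 < C₁ ∧
      ∀ n n₁ : ℕ, 0 < n → 0 < n₁ → (1 + K₁) * (n₁ : ℝ) ≤ (n : ℝ) → n₀ ≤ n₁ →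
      ∀ (start target : G.edgeSet → ℤ) (x z : EuclideanSpace ℝ G.edgeSet),
        SeqAssign.toEuclid start = (n : ℝ) • x →
        x ∈ SeqAssign.region G → δ ≤ Metric.infDist x (SeqAssign.regionBoundary G) →
        SeqAssign.toEuclid target = (n₁ : ℝ) • z →
        z ∈ SeqAssign.region G → δ ≤ Metric.infDist z (SeqAssign.regionBoundary G) →
        ∃ σ : SeqAssign.RandomizedStrategy G,
          c₁ ≤ σ.prob start (n - n₁) {N | SeqAssign.toEuclid N = (n₁ : ℝ) • z} ∧
          ∀ q : ℝ, 1 ≤ q →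
            σ.prob start (n - n₁) {N | q < ‖SeqAssign.toEuclid N - (n₁ : ℝ) • z‖} ≤
              C₁ * Real.exp (-lam₁ * q) := by
  have hEpos : 0 < Fintype.card G.edgeSet := by omega
  have hm : (0 : ℝ) < Fintype.card G.edgeSet := by exact_mod_cast hEpos
  set ε : ℝ := min 1 (δ / (6 * Fintype.card G.edgeSet)) with hεdef
  have hε : 0 < ε := lt_min one_pos (by positivity)
  have hεm : ε * Fintype.card G.edgeSet ≤ δ / 6 := by
    have h1 : ε ≤ δ / (6 * Fintype.card G.edgeSet) := min_le_right _ _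
    rw [le_div_iff₀ (by positivity)] at h1
    linarith
  obtain ⟨c₁, C₁, s, hc₁, hC₁, hmain⟩ := SeqAssign.exists_steering_strategy (G := G)
    (SeqAssign.exists_incident_edge hconn (Fintype.card_pos_iff.1 hEpos)) hε (min_le_left _ _)
    (show 0 < δ / 6 by positivity)
  -- K₁ = 6/δ gives n₁/T ≤ δ/6, and n₀ ensures that T ≥ s, leaving room for the final phase.
  refine ⟨c₁, ε / 16, 6 / δ, C₁, ⌈s * (δ / 6)⌉₊, hc₁, by positivity, by positivity, hC₁, ?_⟩
  intro n n₁ _ hn₁ hn hn₀ start target x z hstart hx hxδ htarget hz hzδ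
  have hn₁' : (0 : ℝ) < n₁ := by exact_mod_cast hn₁
  have hK : 6 / δ * n₁ ≤ (n : ℝ) - n₁ := by linarith
  have hle : n₁ ≤ n := by
    have : (0 : ℝ) < 6 / δ * n₁ := by positivity
    have : (n₁ : ℝ) ≤ n := by linarith
    exact_mod_cast this
  have hTcast : ((n - n₁ : ℕ) : ℝ) = (n : ℝ) - n₁ := Nat.cast_sub hle
  set T : ℕ := n - n₁
  have hKT : 6 / δ * n₁ ≤ (T : ℝ) := hTcast ▸ hK
  have hT : (0 : ℝ) < T := lt_of_lt_of_le (by positivity) hKT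
  have hratio : (n₁ : ℝ) / T ≤ δ / 6 := by
    rw [div_le_iff₀ hT]
    have h1 := mul_le_mul_of_nonneg_left hKT (show 0 ≤ δ / 6 by positivity)
    have h2 : δ / 6 * (6 / δ * n₁) = n₁ := by field_simp
    linarith
  have hsT : s ≤ T := by
    have h1 : (s : ℝ) * (δ / 6) ≤ n₁ := (Nat.le_ceil _).trans (by exact_mod_cast hn₀)
    have h2 : (s : ℝ) ≤ 6 / δ * n₁ := by
      rw [div_mul_eq_mul_div, le_div_iff₀ hδ]
      linarith
    exact_mod_cast h2.trans hKT
  set w : EuclideanSpace ℝ G.edgeSet := x + ((n₁ : ℝ) / T) • (x - z) with hw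
  have hTw : (T : ℝ) • w = (n : ℝ) • x - (n₁ : ℝ) • z := by
    rw [hw, smul_add, smul_smul, mul_div_cancel₀ _ hT.ne', hTcast]
    module
  have hwF : ∀ F : Finset G.edgeSet, ∑ e ∈ F, w e =
      ∑ e ∈ F, x e + (n₁ : ℝ) / T * (∑ e ∈ F, x e - ∑ e ∈ F, z e) := fun F => by
    simp only [hw, PiLp.add_apply, PiLp.sub_apply, PiLp.smul_apply, smul_eq_mul,
      Finset.sum_add_distrib, ← Finset.mul_sum, Finset.sum_sub_distrib]
  -- Of the margin δ/3 of `x`, the correction towards `x - z` costs at most n₁/T ≤ δ/6, as sums of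
  -- `z` are at most 1.
  have hmargin : ∀ F : Finset G.edgeSet, F.Nonempty → F ≠ Finset.univ →
      (SeqAssign.d G F : ℝ) / Fintype.card V + δ / 6 ≤ ∑ e ∈ F, w e := fun F h0 h1 => by
    have h2 := SeqAssign.region_margin hδ hx hxδ F h0 h1
    have h3 : ∑ e ∈ F, z e ≤ 1 := by
      refine le_of_le_of_eq ?_ hz.1.2
      exact Finset.sum_le_sum_of_subset_of_nonneg (Finset.subset_univ F) fun e _ _ => hz.1.1 e
    have h4 : 0 ≤ ∑ e ∈ F, x e := Finset.sum_nonneg fun e _ => hx.1.1 e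
    have h5 : 0 ≤ (n₁ : ℝ) / T := by positivity
    rw [hwF]
    nlinarith
  obtain ⟨σ, h1, h2⟩ := hmain T start target w hsT
    (by
      have hx1 : ∑ e, x e = 1 := hx.1.2
      have hz1 : ∑ e, z e = 1 := hz.1.2
      rw [hwF, hx1, hz1]
      simp)
    -- Since |E| ≥ 2, a singleton is a proper edge set, and its constraint bounds the coordinate
    -- below by δ/6.
    (fun e => by
      have h := hmargin {e} (Finset.singleton_nonempty e) (fun h => by
        have := congrArg Finset.card h
        rw [Finset.card_singleton, Finset.card_univ] at this
        omega)
      rw [Finset.sum_singleton] at h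
      have : 0 ≤ (SeqAssign.d G {e} : ℝ) / Fintype.card V := by positivity
      linarith)
    (fun F h0 h1 => (add_le_add_right hεm _).trans (hmargin F h0 h1))
    (by rw [hTw, hstart, htarget, sub_sub_cancel])
  rw [htarget] at h1 h2
  exact ⟨σ, h1, fun q _ => h2 q⟩
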